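/- Let $(\Omega,\mathcal A,P)$ be a probability space, $\mathbb X$ a measurable space, $\mathbb S$ a finite set (with the $\sigma$-algebra of all subsets), and let $\mathcal H$ be a real reproducing kernel Hilbert space of functions on $\mathbb X$ whose feature map $\phi:\mathbb X\to\mathcal H$, $\langle\phi(x),h\rangle=h(x)$, is Bochner measurable. Let $(X,S),(X_1,S_1),(X_2,S_2),\dots$ be i.i.d. random variables on $\Omega$ with values in $\mathbb X\times\mathbb S$, such that $\phi(X)$ is Bochner integrable, and let $E^S\phi(X)$ be the $\mathcal H$-valued conditional expectation of $\phi(X)$ given $\sigma(S)$. For $B\subseteq\mathbb S$ put $P_n(S\in B)=\frac1n\sum_{i=1}^n\chi\{S_i\in B\}$ and $$E_n(\phi(X)\mid S\in B)=\frac{1}{n\,P_n(S\in B)}\sum_{i=1}^n\phi(X_i)\,\chi\{S_i\in B\}$$ if $P_n(S\in B)>0$, and $E_n(\phi(X)\mid S\in B)=0$ otherwise. The plug-in estimator is $$E_n^S\phi(X)=\sum_{s\in\mathbb S}E_n(\phi(X)\mid S\in\{s\})\,\chi\{S=s\}.$$ With $\mathcal F_n=\sigma(X_1,S_1,\dots,X_n,S_n)$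 define the conditional $L^2$-pseudo-norm by $$\|E_n^S\phi(X)-E^S\phi(X)\|_{2,n}=\Bigl(E\bigl[\,\|E_n^S\phi(X)-E^S\phi(X)\|^2\,\big|\,\mathcal F_n\bigr]\Bigr)^{1/2}.$$ Suppose that the class $$\mathcal H_{\mathbb S}=\{(h\circ\pi_1)\cdot\chi(\mathbb X\times\{s\}) : h\in\mathcal H,\ \|h\|\le1,\ s\in\mathbb S\},\qquad \pi_1(x,s)=x,$$ of real functions on $\mathbb X\times\mathbb S$ is a Donsker class for the law $Q$ of $(X,S)$. That is, $\mathcal H_{\mathbb S}\subset L^2(Q)$, the empirical processes $\sqrt n\,(Q_n-Q)$ (on the coordinates of the product space $((\mathbb X\times\mathbb S)^{\mathbb N},Q^{\mathbb N})$) take values in $\ell^\infty(\mathcal H_{\mathbb S})$ and converge in law there, in the sense of Hoffmann-Jørgensen (outer expectations of bounded continuous functionals), to a centred Gaussian process with covariance $Q(fg)-Qf\,Qg$ whose sample paths are bounded and uniformly continuous for the pseudo-metric $(\mathrm{Var}_Q(f-g))^{1/2}$. Then $$\|E_n^S\phi(X)-E^S\phi(X)\|_{2,n}\in O_P^*(n^{-1/2}),$$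 that is, for every $\varepsilon>0$ there is an $M>0$ such that for all sufficiently large $n$ the outer probability of the event $\|E_n^S\phi(X)-E^S\phi(X)\|_{2,n}>M\,n^{-1/2}$ is at most $\varepsilon$. -/

import Mathlib

open MeasureTheory ProbabilityTheory Filter Topology
open scoped ENNReal BoundedContinuousFunction

universe u

noncomputable section

/-! ### Stochastic order in outer probability -/

/-- `Y n ∈ O*_P(r n)`: the sequence `Y n / r n` is bounded in outer probability, i.e. for every
`ε > 0` there is an `M` with `limsup_n P^*(Y n > M * r n) ≤ ε`.  A Mathlib measure evaluated at an
arbitrary set is the outer measure of that set, so no measurability of `Y n` is involved. -/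
def IsBigOStarP {Ω : Type*} [MeasurableSpace Ω] (P : Measure Ω) (Y : ℕ → Ω → ℝ≥0∞)
    (r : ℕ → ℝ) : Prop :=
  ∀ ε : ℝ≥0∞, 0 < ε → ∃ M : ℝ, 0 < M ∧
    ∀ᶠ n : ℕ in atTop, P {ω | ENNReal.ofReal (M * r n) < Y n ω} ≤ ε

/-! ### Donsker classes -/

/-- Outer expectation of a bounded function `g`: the infimum of `E u` over all integrable
`u ≥ g`. -/
def outerExpectation {Ω : Type*} [MeasurableSpace Ω] (P : Measure Ω) (g : Ω → ℝ) : ℝ :=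
  sInf {r : ℝ | ∃ u : Ω → ℝ, Integrable u P ∧ (∀ ω, g ω ≤ u ω) ∧ r = ∫ ω, u ω ∂P}

/-- The space `ℓ^∞(F)` of bounded real functions on `F` with the supremum norm. -/
abbrev EllInfty {Z : Type*} (F : Set (Z → ℝ)) := lp (fun _ : F => ℝ) ∞

/-- The empirical process `√n (Q_n f - Q f)` built from the first `n` entries of `z`. -/
def empiricalProcess {Z : Type*} [MeasurableSpace Z] (Q : Measure Z) (n : ℕ) (f : Z → ℝ)
    (z : ℕ → Z) : ℝ :=
  √(n : ℝ) * ((n : ℝ)⁻¹ * ∑ i ∈ Finset.range n, f (z i) - ∫ x, f x ∂Q)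

/-- `G` is a version of the `Q`-bridge `G_Q` on `F`: a centred Gaussian process indexed by `F` with
covariance `E (G f * G g) = Q(fg) - Q f * Q g`, every path of which is bounded (as an element of
`ℓ^∞(F)`) and uniformly continuous for the pseudo-metric `ρ_Q(f, g) = (Var_Q (f - g))^{1/2}`. -/
structure IsCoherentBridge {Z : Type*} [MeasurableSpace Z] (Q : Measure Z) (F : Set (Z → ℝ))
    {Ω' : Type*} [MeasurableSpace Ω'] (μ : Measure Ω') (G : Ω' → EllInfty F) : Prop where
  gaussian : IsGaussianProcess (fun (f : F) (ω : Ω') => G ω f) μ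
  centred : ∀ f : F, ∫ ω, G ω f ∂μ = 0
  covariance : ∀ f g : F, ∫ ω, G ω f * G ω g ∂μ =
    ∫ x, f.1 x * g.1 x ∂Q - (∫ x, f.1 x ∂Q) * ∫ x, g.1 x ∂Q
  uniformContinuous : ∀ ω, ∀ ε : ℝ, 0 < ε → ∃ δ : ℝ, 0 < δ ∧ ∀ f g : F,
    √(Var[fun x => f.1 x - g.1 x; Q]) < δ → |G ω f - G ω g| < ε

/-- Convergence in law in the sense of Hoffmann-Jørgensen: the `V n` are arbitrary maps, the limit
`G` is (almost everywhere equal to) a Borel map with separable range, and `E^* Φ(V n) → E Φ(G)` for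
every bounded continuous real `Φ`. -/
def ConvergesInLawOuter {Ω Ω' E : Type*} [MeasurableSpace Ω] [MeasurableSpace Ω']
    [TopologicalSpace E] (P : Measure Ω) (V : ℕ → Ω → E) (μ : Measure Ω') (G : Ω' → E) : Prop :=
  AEStronglyMeasurable G μ ∧
    ∀ Φ : E →ᵇ ℝ, Tendsto (fun n => outerExpectation P (fun ω => Φ (V n ω))) atTop
      (𝓝 (∫ ω, Φ (G ω) ∂μ))

/-- `F` is a `Q`-Donsker class (`Q` a probability measure): `F ⊆ L²(Q)`, the empirical process,
defined on the coordinates of the infinite product `(Z^ℕ, Q^ℕ)`, takes values in `ℓ^∞(F)`, the class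
is `Q`-pre-Gaussian, and the empirical process converges in law in `ℓ^∞(F)` to `G_Q`. -/
def IsDonsker {Z : Type u} [MeasurableSpace Z] (Q : Measure Z) (F : Set (Z → ℝ)) : Prop :=
  (∀ f ∈ F, MemLp f 2 Q) ∧
  ∃ V : ℕ → (ℕ → Z) → EllInfty F,
    (∀ (n : ℕ) (z : ℕ → Z) (f : F), V n z f = empiricalProcess Q n f.1 z) ∧
    ∃ (Ω' : Type u) (_ : MeasurableSpace Ω') (μ : Measure Ω') (G : Ω' → EllInfty F),
      IsProbabilityMeasure μ ∧ IsCoherentBridge Q F μ G ∧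
      ConvergesInLawOuter (Measure.infinitePi fun _ : ℕ => Q) V μ G

/-! ### The feature map and the class of test functions -/

section RKHSClass

variable {𝕏 : Type*} (H : Type*) [NormedAddCommGroup H] [InnerProductSpace ℝ H] [RKHS ℝ H 𝕏 ℝ]

/-- The feature map `φ(x) = k(x, ·)`, characterised by `⟪φ(x), h⟫ = h(x)`. -/
def featureMap [CompleteSpace H] (x : 𝕏) : H := RKHS.kerFun H x (1 : ℝ)

/-- The class of all functions `(h ∘ π₁) · χ(𝕏 × {s})` on `𝕏 × 𝕊` with `‖h‖ ≤ 1` and `s ∈ 𝕊`. -/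
def unitBallClass (𝕊 : Type*) : Set (𝕏 × 𝕊 → ℝ) :=
  {f | ∃ (h : H) (s : 𝕊), ‖h‖ ≤ 1 ∧
    f = fun z => h z.1 * (Set.univ ×ˢ {s} : Set (𝕏 × 𝕊)).indicator 1 z}

end RKHSClass

/-! ### The plug-in estimator

`X 0, S 0` is the pair `(X, S)`, and `(X 1, S 1), …, (X n, S n)` is the training sample. -/

section Estimator

variable {Ω 𝕏 𝕊 : Type*}

/-- `P_n(S ∈ B)`. -/
def empProb (S : ℕ → Ω → 𝕊) (n : ℕ) (B : Set 𝕊) (ω : Ω) : ℝ :=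
  (n : ℝ)⁻¹ * ∑ i ∈ Finset.Icc 1 n, B.indicator (fun _ => (1 : ℝ)) (S i ω)

variable (H : Type*) [NormedAddCommGroup H] [InnerProductSpace ℝ H] [CompleteSpace H]
  [RKHS ℝ H 𝕏 ℝ]

open Classical in
/-- `E_n(φ(X) | S ∈ B)`, with value `0` if no observation falls into `B`. -/
def empCondMean (X : ℕ → Ω → 𝕏) (S : ℕ → Ω → 𝕊) (n : ℕ) (B : Set 𝕊) (ω : Ω) : H :=
  if 0 < empProb S n B ω then
    ((n : ℝ) * empProb S n B ω)⁻¹ •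
      ∑ i ∈ Finset.Icc 1 n, B.indicator (fun _ => (1 : ℝ)) (S i ω) • featureMap H (X i ω)
  else 0

/-- `E_n^S φ(X)`, for the partition of a finite `𝕊` into its points. -/
def plugIn [Fintype 𝕊] (X : ℕ → Ω → 𝕏) (S : ℕ → Ω → 𝕊) (n : ℕ) (ω : Ω) : H :=
  ∑ s : 𝕊, (S 0 ⁻¹' {s}).indicator (fun _ => (1 : ℝ)) ω • empCondMean H X S n {s} ω

variable [MeasurableSpace 𝕏] [MeasurableSpace 𝕊]

/-- `E^S φ(X)`, the Bochner conditional expectation given `σ(S)`. -/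
def condMean [MeasurableSpace Ω] (P : Measure Ω) (X : ℕ → Ω → 𝕏) (S : ℕ → Ω → 𝕊) : Ω → H :=
  P[fun ω => featureMap H (X 0 ω) | MeasurableSpace.comap (S 0) inferInstance]

/-- `σ(X_1, S_1, …, X_n, S_n)`. -/
@[reducible] def trainingSigma (X : ℕ → Ω → 𝕏) (S : ℕ → Ω → 𝕊) (n : ℕ) : MeasurableSpace Ω :=
  ⨆ i ∈ Finset.Icc 1 n, MeasurableSpace.comap (fun ω => (X i ω, S i ω)) inferInstance

end Estimator

/-- The conditional `L²`-pseudo-norm `(E(‖D‖² | 𝓕))^{1/2}`, with the conditional expectation of the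
nonnegative function `‖D‖²` taken in `[0, ∞]`. -/
def condL2Norm {Ω E : Type*} [MeasurableSpace Ω] [NormedAddCommGroup E] (P : Measure Ω)
    (𝓕 : MeasurableSpace Ω) (D : Ω → E) (ω : Ω) : ℝ≥0∞ :=
  (condLExp 𝓕 P (fun ω' => ‖D ω'‖ₑ ^ 2) ω) ^ (1 / 2 : ℝ)

end

/-! ### Boundedness in outer probability of sequences converging in law -/

/-! Write `p s` for the probability of the cell `S = s`, `q` for its empirical frequency and `w` for
the average of `χ{S_i = s} φ(X_i)`. The conditional mean equals some `g s` on the cell, where `p s •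
g s` is the integral of `φ(X)` over the cell. As the fresh `S` is independent of the training
sample, the squared conditional norm is almost surely `∑ p s * ‖E_n(φ(X) | S = s) - g s‖²`, so
finitely many cell errors remain, and null cells do not count.

On a charged cell with `q > 0` the error is `q⁻¹ • ((w - p s • g s) + (p s - q) • g s)`. Chebyshev
controls `p s - q`. By duality `√n ‖w - p s • g s‖` is at most the sup norm of the empirical process
over the unit-ball class, and convergence in law bounds that norm in outer probability. Both terms
are thus of order `n^(-1/2)`, while `q` stays above `p s / 2`. -/

theorem outerExpectation_lt_exists {Ω : Type*} [MeasurableSpace Ω] {P : Measure Ω}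
    [IsFiniteMeasure P] {g : Ω → ℝ} {C c : ℝ} (hg : ∀ ω, g ω ≤ C)
    (hc : outerExpectation P g < c) :
    ∃ u : Ω → ℝ, Integrable u P ∧ (∀ ω, g ω ≤ u ω) ∧ ∫ ω, u ω ∂P < c := by
  -- The bound `C` supplies an integrable majorant; an empty set would have infimum `0` by
  -- convention.
  have hne : {r : ℝ | ∃ u : Ω → ℝ, Integrable u P ∧ (∀ ω, g ω ≤ u ω) ∧
      r = ∫ ω, u ω ∂P}.Nonempty := ⟨_, fun _ => C, integrable_const C, hg, rfl⟩
  obtain ⟨r, ⟨u, hu, hgu, rfl⟩, hr⟩ := exists_lt_of_csInf_lt hne hc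
  exact ⟨u, hu, hgu, hr⟩

/-- The bounded continuous function `v ↦ min 1 (‖v‖ - M)⁺`. -/
noncomputable def normCutoff (E : Type*) [NormedAddCommGroup E] (M : ℝ) : E →ᵇ ℝ :=
  BoundedContinuousFunction.ofNormedAddCommGroup (fun v : E => min 1 (max 0 (‖v‖ - M)))
    (by fun_prop) 1 (fun v => by
      rw [Real.norm_of_nonneg (le_min zero_le_one (le_max_left _ _))]
      exact min_le_left _ _)

theorem normCutoff_apply {E : Type*} [NormedAddCommGroup E] (M : ℝ) (v : E) :
    normCutoff E M v = min 1 (max 0 (‖v‖ - M)) := rfl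

theorem tendsto_integral_normCutoff {Ω E : Type*} [MeasurableSpace Ω] [NormedAddCommGroup E]
    {μ : Measure Ω} [IsFiniteMeasure μ] {G : Ω → E} (hG : AEStronglyMeasurable G μ) :
    Tendsto (fun k : ℕ => ∫ ω, normCutoff E k (G ω) ∂μ) atTop (𝓝 0) := by
  have h : Tendsto (fun k : ℕ => ∫ ω, normCutoff E k (G ω) ∂μ) atTop
      (𝓝 (∫ _, (0 : ℝ) ∂μ)) := by
    refine tendsto_integral_of_dominated_convergence (fun _ => (1 : ℝ)) ?_
      (integrable_const _) ?_ ?_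
    · exact fun k => (normCutoff E k).continuous.comp_aestronglyMeasurable hG
    · refine fun k => Eventually.of_forall fun ω => ?_
      rw [normCutoff_apply, Real.norm_of_nonneg (le_min zero_le_one (le_max_left _ _))]
      exact min_le_left _ _
    · refine Eventually.of_forall fun ω => tendsto_const_nhds.congr' ?_
      obtain ⟨k₀, hk₀⟩ := exists_nat_ge ‖G ω‖
      filter_upwards [eventually_ge_atTop k₀] with k hk
      have : ‖G ω‖ ≤ k := hk₀.trans (by exact_mod_cast hk)
      rw [normCutoff_apply, max_eq_left (by linarith), min_eq_right zero_le_one]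
  simpa using h

/-- The limit has small cutoff expectation for large `k`, convergence in law passes this to the
outer expectations, and Markov's inequality applies to an integrable majorant of the cutoff. -/
theorem ConvergesInLawOuter.exists_measure_norm_gt_le {Ω Ω' E : Type*} [MeasurableSpace Ω]
    [MeasurableSpace Ω'] [NormedAddCommGroup E] {P : Measure Ω} [IsFiniteMeasure P]
    {V : ℕ → Ω → E} {μ : Measure Ω'} [IsFiniteMeasure μ] {G : Ω' → E}
    (h : ConvergesInLawOuter P V μ G) {η : ℝ} (hη : 0 < η) :
    ∃ M : ℝ, 0 < M ∧ ∀ᶠ n in atTop, P {ω | M < ‖V n ω‖} ≤ ENNReal.ofReal η := by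
  obtain ⟨k, hk⟩ := ((tendsto_integral_normCutoff h.1).eventually (gt_mem_nhds hη)).exists
  -- The cutoff at `k` reaches the value `1` only at norm `k + 1`.
  refine ⟨k + 1, by positivity, ?_⟩
  filter_upwards [(h.2 (normCutoff E k)).eventually (gt_mem_nhds hk)] with n hn
  obtain ⟨u, hu, hVu, hu'⟩ := outerExpectation_lt_exists (fun ω => min_le_left _ _) hn
  have hu0 : ∀ ω, 0 ≤ u ω := fun ω => (le_min zero_le_one (le_max_left _ _)).trans (hVu ω)
  have hsub : {ω | (k : ℝ) + 1 < ‖V n ω‖} ⊆ {ω | 1 ≤ u ω} := fun ω hω => by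
    refine le_trans (le_min le_rfl ?_) (hVu ω)
    have : (k : ℝ) + 1 < ‖V n ω‖ := hω
    exact le_max_of_le_right (by linarith)
  refine (measure_mono hsub).trans ?_
  have hmarkov := mul_meas_ge_le_integral_of_nonneg (Eventually.of_forall hu0) hu 1
  rw [one_mul] at hmarkov
  rw [← ENNReal.ofReal_toReal (measure_ne_top P {ω | 1 ≤ u ω})]
  exact ENNReal.ofReal_le_ofReal (hmarkov.trans hu'.le)

/-! ### Kernel means over a cell -/

section KernelMean

variable {𝕏 𝕊 : Type*} (H : Type*) [NormedAddCommGroup H] [InnerProductSpace ℝ H]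
  [CompleteSpace H] [RKHS ℝ H 𝕏 ℝ]

theorem inner_featureMap (x : 𝕏) (h : H) : inner ℝ (featureMap H x) h = h x := by
  simp [featureMap]

/-- The `H`-valued function `(x, t) ↦ χ{t = s} φ(x)`. -/
noncomputable def cellFeature (s : 𝕊) (z : 𝕏 × 𝕊) : H :=
  ({s} : Set 𝕊).indicator (fun _ => (1 : ℝ)) z.2 • featureMap H z.1

theorem inner_cellFeature (s : 𝕊) (z : 𝕏 × 𝕊) (h : H) :
    inner ℝ h (cellFeature H s z) =
      h z.1 * (Set.univ ×ˢ {s} : Set (𝕏 × 𝕊)).indicator 1 z := by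
  rw [cellFeature, inner_smul_right, real_inner_comm, inner_featureMap, mul_comm]
  congr 1
  by_cases hz : z.2 = s <;> simp [Set.indicator, hz]

/-- Testing the centred mean `w` against its own direction attains its norm, and pairing with a
unit-ball vector gives a coordinate of the empirical process. For `w = 0` the direction is `0`,
still in the ball. -/
theorem norm_sum_cellFeature_sub_le [MeasurableSpace 𝕏] [MeasurableSpace 𝕊]
    {Q : Measure (𝕏 × 𝕊)} (s : 𝕊) (hint : Integrable (cellFeature H s) Q) (n : ℕ)
    (z : ℕ → 𝕏 × 𝕊) (v : EllInfty (unitBallClass H 𝕊 : Set (𝕏 × 𝕊 → ℝ)))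
    (hv : ∀ f : (unitBallClass H 𝕊 : Set (𝕏 × 𝕊 → ℝ)), v f = empiricalProcess Q n f.1 z) :
    √(n : ℝ) * ‖(n : ℝ)⁻¹ • ∑ i ∈ Finset.range n, cellFeature H s (z i)
      - ∫ x, cellFeature H s x ∂Q‖ ≤ ‖v‖ := by
  set w := (n : ℝ)⁻¹ • ∑ i ∈ Finset.range n, cellFeature H s (z i)
      - ∫ x, cellFeature H s x ∂Q with hw
  set h : H := ‖w‖⁻¹ • w
  have hh : ‖h‖ ≤ 1 := by
    rw [norm_smul, norm_inv, norm_norm]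
    exact inv_mul_le_one
  let f : (unitBallClass H 𝕊 : Set (𝕏 × 𝕊 → ℝ)) := ⟨_, h, s, hh, rfl⟩
  have hf : ∀ x, f.1 x = inner ℝ h (cellFeature H s x) := fun x => (inner_cellFeature H s x h).symm
  have hvf : v f = √(n : ℝ) * inner ℝ h w := by
    rw [hv, empiricalProcess, hw, inner_sub_right, inner_smul_right, inner_sum]
    simp_rw [hf]
    rw [integral_inner hint]
  have hhw : inner ℝ h w = ‖w‖ := by
    rw [inner_smul_left, real_inner_self_eq_norm_sq]
    rcases eq_or_ne ‖w‖ 0 with h0 | h0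
    · simp [h0]
    · simp only [map_inv₀, conj_trivial]
      field_simp
  calc √(n : ℝ) * ‖w‖ = v f := by rw [hvf, hhw]
    _ ≤ ‖v f‖ := Real.le_norm_self _
    _ ≤ ‖v‖ := lp.norm_apply_le_norm ENNReal.top_ne_zero v f

end KernelMean

/-! ### Conditioning on a finite-valued variable -/

/-- A `σ(S)`-measurable function factors through `S`. The product form avoids dividing by the mass
of a null fibre. -/
theorem exists_condExp_comap_eq {Ω 𝕊 E : Type*} [MeasurableSpace Ω] [MeasurableSpace 𝕊]
    [MeasurableSingletonClass 𝕊] [NormedAddCommGroup E] [NormedSpace ℝ E] [CompleteSpace E]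
    (P : Measure Ω) [IsFiniteMeasure P] {S : Ω → 𝕊} (hS : Measurable S) {Y : Ω → E}
    (hY : Integrable Y P) :
    ∃ g : 𝕊 → E, P[Y | MeasurableSpace.comap S inferInstance] = g ∘ S ∧
      ∀ s, P.real (S ⁻¹' {s}) • g s = ∫ ω in S ⁻¹' {s}, Y ω ∂P := by
  obtain ⟨g, hg⟩ : ∃ g : 𝕊 → E, P[Y | MeasurableSpace.comap S inferInstance] = g ∘ S := by
    let _ : MeasurableSpace E := borel E
    have : BorelSpace E := ⟨rfl⟩
    have h := (stronglyMeasurable_condExp (m := MeasurableSpace.comap S inferInstance)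
      (μ := P) (f := Y)).factorsThrough
    refine ⟨Function.extend S (P[Y | MeasurableSpace.comap S inferInstance]) 0, ?_⟩
    funext ω
    exact (h.extend_apply _ ω).symm
  refine ⟨g, hg, fun s => ?_⟩
  rw [← setIntegral_condExp hS.comap_le hY ⟨{s}, measurableSet_singleton s, rfl⟩, hg,
    setIntegral_congr_fun (g := fun _ => g s) (hS (measurableSet_singleton s))
      (fun ω hω => by rw [Function.comp_apply, show S ω = s from hω])]
  simp [Measure.real]

/-- On a test set `t` of `m`, the fibre indicator is independent of `t.indicator (f s)`, so the
integral of their product factors. -/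
theorem condLExp_sum_indicator_mul {Ω 𝕊 : Type*} {m : MeasurableSpace Ω}
    [m0 : MeasurableSpace Ω] [Fintype 𝕊] [MeasurableSpace 𝕊] [MeasurableSingletonClass 𝕊]
    (P : Measure Ω) [IsProbabilityMeasure P] {S : Ω → 𝕊} (hS : Measurable S) (hm : m ≤ m0)
    (hind : Indep (MeasurableSpace.comap S inferInstance) m P) {f : 𝕊 → Ω → ℝ≥0∞}
    (hf : ∀ s, Measurable[m] (f s)) :
    condLExp m P (fun ω => ∑ s, (S ⁻¹' {s}).indicator (fun _ => (1 : ℝ≥0∞)) ω * f s ω)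
      =ᵐ[P] fun ω => ∑ s, P (S ⁻¹' {s}) * f s ω := by
  have hms : ∀ s, MeasurableSet (S ⁻¹' {s}) := fun s => hS (measurableSet_singleton s)
  have hf' : ∀ s, Measurable (f s) := fun s => (hf s).mono hm le_rfl
  refine (ae_eq_condLExp hm P _ (Finset.measurable_fun_sum _ fun s _ =>
    (hf s).const_mul _) fun t ht => ?_).symm
  rw [lintegral_finsetSum _ fun s _ => (hf' s).const_mul _, lintegral_finsetSum _ fun s _ =>
    (measurable_const.indicator (hms s)).fun_mul (hf' s)]
  refine Finset.sum_congr rfl fun s _ => ?_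
  rw [lintegral_const_mul _ (hf' s), ← lintegral_indicator (hm t ht),
    ← lintegral_indicator (hm t ht)]
  have hprod : t.indicator (fun ω => (S ⁻¹' {s}).indicator (fun _ => (1 : ℝ≥0∞)) ω * f s ω)
      = fun ω => (S ⁻¹' {s}).indicator (fun _ => (1 : ℝ≥0∞)) ω * t.indicator (f s) ω := by
    funext ω
    by_cases h : ω ∈ t <;> simp [h]
  rw [hprod, lintegral_mul_eq_lintegral_mul_lintegral_of_independent_measurableSpace
    hS.comap_le hm hind
    (measurable_const.indicator ⟨{s}, measurableSet_singleton s, rfl⟩) ((hf s).indicator ht),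
    lintegral_indicator_const (hms s), one_mul]

/-! ### Cell frequencies and cell sums of the training sample -/

theorem sum_Icc_one_eq_sum_range {M : Type*} [AddCommMonoid M] (f : ℕ → M) (n : ℕ) :
    ∑ i ∈ Finset.Icc 1 n, f i = ∑ i ∈ Finset.range n, f (i + 1) := by
  rw [Finset.range_eq_Ico, Finset.sum_Ico_add' f 0 n 1]
  rfl

theorem measure_sqrt_mul_abs_mean_sub_ge_le {Ω : Type*} [MeasurableSpace Ω] {P : Measure Ω}
    [IsProbabilityMeasure P] {Y : ℕ → Ω → ℝ} {p c : ℝ} (hY : ∀ i, Measurable (Y i))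
    (h01 : ∀ i ω, Y i ω ∈ Set.Icc (0 : ℝ) 1) (hind : Pairwise fun i j => Y i ⟂ᵢ[P] Y j)
    (hp : ∀ i, ∫ ω, Y i ω ∂P = p) (hc : 0 < c) (s : Finset ℕ) (hs : s.Nonempty) :
    P {ω | c ≤ √(s.card : ℝ) * |(s.card : ℝ)⁻¹ * ∑ i ∈ s, Y i ω - p|}
      ≤ ENNReal.ofReal (1 / c ^ 2) := by
  have hn : (0 : ℝ) < s.card := by exact_mod_cast hs.card_pos
  have hLp : ∀ i, MemLp (Y i) 2 P := fun i =>
    memLp_of_bounded (Eventually.of_forall (h01 i)) (hY i).aestronglyMeasurable 2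
  have hsum : MemLp (∑ i ∈ s, Y i) 2 P := memLp_finsetSum' s fun i _ => hLp i
  have hmean : ∫ ω, (∑ i ∈ s, Y i) ω ∂P = s.card * p := by
    simp_rw [Finset.sum_apply]
    rw [integral_finsetSum _ fun i _ => (hLp i).integrable one_le_two]
    simp [hp]
  have hvar : Var[∑ i ∈ s, Y i; P] ≤ s.card := by
    rw [IndepFun.variance_sum (fun i _ => hLp i) fun i _ j _ hij => hind hij]
    refine (Finset.sum_le_sum (g := fun _ => (1 : ℝ)) fun i _ => ?_).trans (by simp)
    refine (variance_le_sq_of_bounded (Eventually.of_forall (h01 i)) (hY i).aemeasurable).trans ?_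
    norm_num
  have hcheb := meas_ge_le_variance_div_sq hsum (c := c * √(s.card : ℝ)) (by positivity)
  rw [hmean] at hcheb
  refine (measure_mono fun ω hω => ?_).trans (hcheb.trans (ENNReal.ofReal_le_ofReal ?_))
  · simp only [Set.mem_ofPred_eq, Finset.sum_apply] at hω ⊢
    have hfac : ∑ i ∈ s, Y i ω - s.card * p
        = s.card * ((s.card : ℝ)⁻¹ * ∑ i ∈ s, Y i ω - p) := by field_simp
    rw [hfac, abs_mul, abs_of_pos hn]
    calc c * √(s.card : ℝ) ≤ _ := mul_le_mul_of_nonneg_right hω (Real.sqrt_nonneg _)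
      _ = (√(s.card : ℝ) * √(s.card : ℝ)) * |(s.card : ℝ)⁻¹ * ∑ i ∈ s, Y i ω - p| := by ring
      _ = _ := by rw [Real.mul_self_sqrt hn.le]
  · rw [mul_pow, Real.sq_sqrt hn.le, div_le_div_iff₀ (by positivity) (by positivity)]
    nlinarith [sq_nonneg c]

theorem measure_sqrt_mul_abs_empProb_sub_ge_le {Ω 𝕊 : Type*} [MeasurableSpace Ω]
    [MeasurableSpace 𝕊] {P : Measure Ω} [IsProbabilityMeasure P] {S : ℕ → Ω → 𝕊}
    (hS : ∀ i, Measurable (S i)) (hind : iIndepFun S P)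
    (hident : ∀ i, IdentDistrib (S i) (S 0) P P) {B : Set 𝕊} (hB : MeasurableSet B) {c : ℝ}
    (hc : 0 < c) {n : ℕ} (hn : 0 < n) :
    P {ω | c ≤ √(n : ℝ) * |empProb S n B ω - P.real (S 0 ⁻¹' B)|}
      ≤ ENNReal.ofReal (1 / c ^ 2) := by
  have hm : Measurable (B.indicator fun _ => (1 : ℝ)) := measurable_const.indicator hB
  have h := measure_sqrt_mul_abs_mean_sub_ge_le (P := P)
    (Y := fun i ω => B.indicator (fun _ => (1 : ℝ)) (S i ω)) (p := P.real (S 0 ⁻¹' B))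
    (fun i => hm.comp (hS i)) (fun i ω => by by_cases h : S i ω ∈ B <;> simp [h])
    (fun i j hij => (hind.indepFun hij).comp hm hm) (fun i => ?_) hc (Finset.Icc 1 n)
    (Finset.nonempty_Icc.2 hn)
  · simpa [empProb] using h
  · refine ((hident i).comp hm).integral_eq.trans ?_
    exact integral_indicator_one (hS 0 hB)

/-! ### Measurability and error of the empirical cell means -/

section Estimator

variable {Ω 𝕏 𝕊 : Type*} (H : Type*) [NormedAddCommGroup H] [InnerProductSpace ℝ H]
  [CompleteSpace H] [RKHS ℝ H 𝕏 ℝ]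

theorem measurable_trainingSigma [MeasurableSpace 𝕏] [MeasurableSpace 𝕊] (X : ℕ → Ω → 𝕏)
    (S : ℕ → Ω → 𝕊) {n i : ℕ} (hi : i ∈ Finset.Icc 1 n) :
    Measurable[trainingSigma X S n] fun ω => (X i ω, S i ω) :=
  Measurable.mono (comap_measurable _)
    (le_iSup₂ (f := fun i (_ : i ∈ Finset.Icc 1 n) =>
      MeasurableSpace.comap (fun ω => (X i ω, S i ω)) inferInstance) i hi) le_rfl

theorem stronglyMeasurable_empCondMean [MeasurableSpace 𝕏] [MeasurableSpace 𝕊]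
    (hφ : StronglyMeasurable (featureMap H : 𝕏 → H)) (X : ℕ → Ω → 𝕏) (S : ℕ → Ω → 𝕊) (n : ℕ)
    {B : Set 𝕊} (hB : MeasurableSet B) :
    StronglyMeasurable[trainingSigma X S n] (empCondMean H X S n B) := by
  let _ : MeasurableSpace Ω := trainingSigma X S n
  have hX : ∀ i ∈ Finset.Icc 1 n, Measurable (X i) := fun i hi =>
    (measurable_trainingSigma X S hi).fst
  have hS : ∀ i ∈ Finset.Icc 1 n, Measurable (S i) := fun i hi =>
    (measurable_trainingSigma X S hi).snd
  have hm : Measurable (B.indicator fun _ => (1 : ℝ)) := measurable_const.indicator hB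
  have hp : Measurable (empProb S n B) := by
    unfold empProb
    exact (Finset.measurable_fun_sum _ fun i hi => hm.comp (hS i hi)).const_mul _
  unfold empCondMean
  refine StronglyMeasurable.ite (measurableSet_lt measurable_const hp)
    (StronglyMeasurable.smul ?_ ?_) stronglyMeasurable_const
  · exact (hp.const_mul _).inv.stronglyMeasurable
  · exact Finset.stronglyMeasurable_fun_sum _ fun i hi =>
      (hm.comp (hS i hi)).stronglyMeasurable.smul (hφ.comp_measurable (hX i hi))

/-- A pointwise ratio estimate: `hb` forces the empirical frequency above `p / 2`, which excludes
the default branch and bounds the inverse by `2 / p`. -/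
theorem norm_empCondMean_sub_le (X : ℕ → Ω → 𝕏) (S : ℕ → Ω → 𝕊) {n : ℕ} {s : 𝕊} {ω : Ω}
    {p r a b : ℝ} {g : H} (hp : 0 < p) (hb : b * r ≤ p / 2)
    (hprob : |empProb S n {s} ω - p| ≤ b * r)
    (hsum : ‖(n : ℝ)⁻¹ • ∑ i ∈ Finset.range n, cellFeature H s (X (i + 1) ω, S (i + 1) ω)
      - p • g‖ ≤ a * r) :
    ‖empCondMean H X S n {s} ω - g‖ ≤ 2 / p * (a + b * ‖g‖) * r := by
  set q := empProb S n {s} ω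
  set w := (n : ℝ)⁻¹ • ∑ i ∈ Finset.range n, cellFeature H s (X (i + 1) ω, S (i + 1) ω)
  have hq : p / 2 ≤ q := by linarith [(abs_le.1 hprob).1]
  have hq0 : 0 < q := by linarith
  have hE : empCondMean H X S n {s} ω = q⁻¹ • w := by
    rw [empCondMean, if_pos hq0, sum_Icc_one_eq_sum_range, mul_inv, mul_comm, mul_smul]
    rfl
  have hsplit : empCondMean H X S n {s} ω - g = q⁻¹ • ((w - p • g) + (p - q) • g) := by
    have hqg : q⁻¹ • q • g = g := inv_smul_smul₀ hq0.ne' g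
    rw [hE, sub_smul, sub_add_sub_cancel, smul_sub, hqg]
  have hnorm : ‖(w - p • g) + (p - q) • g‖ ≤ a * r + b * r * ‖g‖ := by
    refine (norm_add_le _ _).trans (add_le_add hsum ?_)
    rw [norm_smul, Real.norm_eq_abs, abs_sub_comm]
    gcongr
  have hqp : q⁻¹ ≤ 2 / p := by
    rw [← inv_div]
    exact inv_anti₀ (by positivity) hq
  rw [hsplit, norm_smul, Real.norm_of_nonneg (by positivity)]
  calc q⁻¹ * _ ≤ 2 / p * (a * r + b * r * ‖g‖) := by gcongr
    _ = _ := by ring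

end Estimator

/-! ### The plug-in error and its probabilistic bounds -/

section PlugIn

variable {Ω 𝕏 𝕊 : Type*} (H : Type*) [NormedAddCommGroup H] [InnerProductSpace ℝ H]
  [CompleteSpace H] [RKHS ℝ H 𝕏 ℝ]

theorem cellFeature_comp_eq_indicator (X : Ω → 𝕏) (S : Ω → 𝕊) (s : 𝕊) :
    (fun ω => cellFeature H s (X ω, S ω)) =
      (S ⁻¹' {s}).indicator fun ω => featureMap H (X ω) := by
  funext ω
  by_cases h : S ω = s <;> simp [cellFeature, h]

/-- Exactly one cell contains `ω`, so there are no cross terms. -/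
theorem enorm_plugIn_sub_sq [Fintype 𝕊] (X : ℕ → Ω → 𝕏) (S : ℕ → Ω → 𝕊) (n : ℕ) (g : 𝕊 → H)
    (ω : Ω) :
    ‖plugIn H X S n ω - g (S 0 ω)‖ₑ ^ 2 =
      ∑ s, (S 0 ⁻¹' {s}).indicator (fun _ => (1 : ℝ≥0∞)) ω * ‖empCondMean H X S n {s} ω - g s‖ₑ ^ 2
      := by
  have h0 : ∀ s ≠ S 0 ω, ω ∉ S 0 ⁻¹' {s} := fun s hs h => hs (Eq.symm h)
  rw [plugIn, Finset.sum_eq_single (S 0 ω), Finset.sum_eq_single (S 0 ω)]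
  · simp
  all_goals simp +contextual [h0]

variable [MeasurableSpace Ω] {P : Measure Ω} [MeasurableSpace 𝕏] [MeasurableSpace 𝕊]

theorem indep_comap_trainingSigma {X : ℕ → Ω → 𝕏} {S : ℕ → Ω → 𝕊} (hX : ∀ i, Measurable (X i))
    (hS : ∀ i, Measurable (S i))
    (hindep : iIndepFun (fun (i : ℕ) (ω : Ω) => (X i ω, S i ω)) P) (n : ℕ) :
    Indep (MeasurableSpace.comap (S 0) inferInstance) (trainingSigma X S n) P := by
  have hdisj : Disjoint ({0} : Set ℕ) (Finset.Icc 1 n : Finset ℕ) := by simp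
  have h := indep_iSup_of_disjoint (fun i => ((hX i).prodMk (hS i)).comap_le) hindep.iIndep hdisj
  refine indep_of_indep_of_le_left (by simpa [trainingSigma] using h) ?_
  exact (measurable_snd.comp (comap_measurable fun ω => (X 0 ω, S 0 ω))).comap_le

variable [MeasurableSingletonClass 𝕊]

theorem stronglyMeasurable_cellFeature (hφ : StronglyMeasurable (featureMap H : 𝕏 → H)) (s : 𝕊) :
    StronglyMeasurable (cellFeature H s : 𝕏 × 𝕊 → H) := by
  unfold cellFeature
  refine StronglyMeasurable.smul ?_ (hφ.comp_measurable measurable_fst)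
  exact ((measurable_const.indicator (measurableSet_singleton s)).comp
    measurable_snd).stronglyMeasurable

theorem integrable_cellFeature (hφ : StronglyMeasurable (featureMap H : 𝕏 → H)) {X : Ω → 𝕏}
    {S : Ω → 𝕊} (hX : Measurable X) (hS : Measurable S)
    (hint : Integrable (fun ω => featureMap H (X ω)) P) (s : 𝕊) :
    Integrable (cellFeature H s) (P.map fun ω => (X ω, S ω)) := by
  rw [integrable_map_measure (stronglyMeasurable_cellFeature H hφ s).aestronglyMeasurable
    (hX.prodMk hS).aemeasurable]
  refine Integrable.congr (hint.indicator (hS (measurableSet_singleton s))) ?_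
  exact Eventually.of_forall fun ω => congrFun (cellFeature_comp_eq_indicator H X S s).symm ω

theorem integral_cellFeature (hφ : StronglyMeasurable (featureMap H : 𝕏 → H)) {X : Ω → 𝕏}
    {S : Ω → 𝕊} (hX : Measurable X) (hS : Measurable S) (s : 𝕊) :
    ∫ z, cellFeature H s z ∂(P.map fun ω => (X ω, S ω))
      = ∫ ω in S ⁻¹' {s}, featureMap H (X ω) ∂P := by
  rw [integral_map (hX.prodMk hS).aemeasurable
    (stronglyMeasurable_cellFeature H hφ s).aestronglyMeasurable,
    cellFeature_comp_eq_indicator, integral_indicator (hS (measurableSet_singleton s))]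

variable [IsProbabilityMeasure P]

theorem condL2Norm_plugIn_sub_condMean [Fintype 𝕊]
    (hφ : StronglyMeasurable (featureMap H : 𝕏 → H)) {X : ℕ → Ω → 𝕏} {S : ℕ → Ω → 𝕊}
    (hX : ∀ i, Measurable (X i)) (hS : ∀ i, Measurable (S i))
    (hindep : iIndepFun (fun (i : ℕ) (ω : Ω) => (X i ω, S i ω)) P) {g : 𝕊 → H}
    (hg : condMean H P X S = g ∘ S 0) (n : ℕ) :
    condL2Norm P (trainingSigma X S n) (fun ω => plugIn H X S n ω - condMean H P X S ω) =ᵐ[P]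
      fun ω => (∑ s, P (S 0 ⁻¹' {s}) * ‖empCondMean H X S n {s} ω - g s‖ₑ ^ 2) ^ (1 / 2 : ℝ) := by
  have hle : trainingSigma X S n ≤ ‹MeasurableSpace Ω› :=
    iSup₂_le fun i _ => ((hX i).prodMk (hS i)).comap_le
  have h := condLExp_sum_indicator_mul P (hS 0) hle
    (indep_comap_trainingSigma hX hS hindep n)
    (f := fun s ω => ‖empCondMean H X S n {s} ω - g s‖ₑ ^ 2) (fun s => Measurable.pow_const
      (((stronglyMeasurable_empCondMean H hφ X S n (measurableSet_singleton s)).sub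
        stronglyMeasurable_const).enorm) 2)
  filter_upwards [h] with ω hω
  rw [← hω, condL2Norm, hg]
  simp_rw [Function.comp_apply, enorm_plugIn_sub_sq]

theorem IsDonsker.exists_measure_cellFeature_gt_le
    (hφ : StronglyMeasurable (featureMap H : 𝕏 → H)) {X : ℕ → Ω → 𝕏} {S : ℕ → Ω → 𝕊}
    (hX : ∀ i, Measurable (X i)) (hS : ∀ i, Measurable (S i))
    (hindep : iIndepFun (fun (i : ℕ) (ω : Ω) => (X i ω, S i ω)) P)
    (hident : ∀ i, IdentDistrib (fun ω => (X i ω, S i ω)) (fun ω => (X 0 ω, S 0 ω)) P P)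
    (hint : Integrable (fun ω => featureMap H (X 0 ω)) P)
    (hDonsker : IsDonsker (P.map fun ω => (X 0 ω, S 0 ω))
      (unitBallClass H 𝕊 : Set (𝕏 × 𝕊 → ℝ))) {η : ℝ} (hη : 0 < η) :
    ∃ M : ℝ, 0 < M ∧ ∀ᶠ n : ℕ in atTop, P {ω | ∃ s : 𝕊, M < √(n : ℝ) *
      ‖(n : ℝ)⁻¹ • ∑ i ∈ Finset.range n, cellFeature H s (X (i + 1) ω, S (i + 1) ω)
        - ∫ ω in S 0 ⁻¹' {s}, featureMap H (X 0 ω) ∂P‖} ≤ ENNReal.ofReal η := by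
  obtain ⟨-, V, hV, Ω', _, μ, G, _, -, hconv⟩ := hDonsker
  have hXS : ∀ i, Measurable fun ω => (X i ω, S i ω) := fun i => (hX i).prodMk (hS i)
  have : IsProbabilityMeasure (P.map fun ω => (X 0 ω, S 0 ω)) :=
    Measure.isProbabilityMeasure_map (hXS 0).aemeasurable
  obtain ⟨M, hM, hMn⟩ := hconv.exists_measure_norm_gt_le hη
  refine ⟨M, hM, hMn.mono fun n hn => le_trans ?_ hn⟩
  -- The training sample starts at index 1 and the product coordinates at 0; the shifted sequence
  -- still has law `Q^ℕ`.
  have hshift := (iIndepFun_iff_map_fun_eq_infinitePi_map fun i : ℕ => hXS (i + 1)).1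
    (hindep.precomp (add_left_injective 1))
  simp_rw [(hident _).map_eq] at hshift
  rw [← hshift]
  -- The event need not be measurable; for outer measures only this inequality between preimage and
  -- image law is available, and it has the needed direction.
  refine le_trans (measure_mono ?_)
    (Measure.le_map_apply (measurable_pi_lambda _ fun i => hXS (i + 1)).aemeasurable _)
  rintro ω ⟨s, hs⟩
  refine lt_of_lt_of_le hs ?_
  rw [← integral_cellFeature H hφ (hX 0) (hS 0) s]
  exact norm_sum_cellFeature_sub_le H s (integrable_cellFeature H hφ (hX 0) (hS 0) hint s) n
    (fun i => (X (i + 1) ω, S (i + 1) ω)) _ (hV n _)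

theorem measure_exists_sqrt_mul_abs_empProb_sub_ge_le [Fintype 𝕊] {S : ℕ → Ω → 𝕊}
    (hS : ∀ i, Measurable (S i)) (hind : iIndepFun S P)
    (hident : ∀ i, IdentDistrib (S i) (S 0) P P) {η : ℝ} (hη : 0 < η) :
    ∃ c : ℝ, 0 < c ∧ ∀ n : ℕ, 0 < n →
      P {ω | ∃ s : 𝕊, c ≤ √(n : ℝ) * |empProb S n {s} ω - P.real (S 0 ⁻¹' {s})|}
        ≤ ENNReal.ofReal η := by
  -- The choice `c² = k / η` gives each cell probability at most `η / k` for the union bound; the `+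
  -- 1` keeps `k` positive.
  set k : ℝ := Fintype.card 𝕊 + 1
  have hk : 0 < k := by positivity
  refine ⟨√(k / η), by positivity, fun n hn => ?_⟩
  rw [Set.ofPred_exists]
  refine (measure_iUnion_fintype_le P _).trans ((Finset.sum_le_sum fun s _ =>
    measure_sqrt_mul_abs_empProb_sub_ge_le hS hind hident (measurableSet_singleton s)
      (by positivity) hn).trans ?_)
  rw [Real.sq_sqrt (by positivity), one_div_div, ← ENNReal.ofReal_sum_of_nonneg
    (fun _ _ => by positivity)]
  refine ENNReal.ofReal_le_ofReal ?_
  rw [Finset.sum_const, Finset.card_univ, nsmul_eq_mul, mul_div_assoc', div_le_iff₀ hk, mul_comm]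
  exact mul_le_mul_of_nonneg_left (by simp [k]) hη.le

end PlugIn

/-! ### Assembling the rate -/

theorem sum_measure_fiber_eq_one {Ω 𝕊 : Type*} [MeasurableSpace Ω] [Fintype 𝕊]
    [MeasurableSpace 𝕊] [MeasurableSingletonClass 𝕊] (P : Measure Ω) [IsProbabilityMeasure P]
    {S : Ω → 𝕊} (hS : Measurable S) : ∑ s, P (S ⁻¹' {s}) = 1 := by
  rw [sum_measure_preimage_singleton _ fun s _ => hS (measurableSet_singleton s)]
  simp

theorem proposition4
    {Ω : Type*} [MeasurableSpace Ω] (P : Measure Ω) [IsProbabilityMeasure P]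
    {𝕏 : Type*} [MeasurableSpace 𝕏]
    {𝕊 : Type*} [Fintype 𝕊] [MeasurableSpace 𝕊] [MeasurableSingletonClass 𝕊]
    (H : Type*) [NormedAddCommGroup H] [InnerProductSpace ℝ H] [CompleteSpace H] [RKHS ℝ H 𝕏 ℝ]
    (hφ : StronglyMeasurable (featureMap H : 𝕏 → H))
    (X : ℕ → Ω → 𝕏) (S : ℕ → Ω → 𝕊)
    (hX : ∀ i, Measurable (X i)) (hS : ∀ i, Measurable (S i))
    (hindep : iIndepFun (fun (i : ℕ) (ω : Ω) => (X i ω, S i ω)) P)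
    (hident : ∀ i, IdentDistrib (fun ω => (X i ω, S i ω)) (fun ω => (X 0 ω, S 0 ω)) P P)
    (hint : Integrable (fun ω => featureMap H (X 0 ω)) P)
    (hDonsker : IsDonsker (P.map fun ω => (X 0 ω, S 0 ω))
      (unitBallClass H 𝕊 : Set (𝕏 × 𝕊 → ℝ))) :
    IsBigOStarP P
      (fun n => condL2Norm P (trainingSigma X S n)
        (fun ω => plugIn H X S n ω - condMean H P X S ω))
      (fun n => (n : ℝ) ^ (-(1 / 2) : ℝ)) := by
  have hSind : iIndepFun S P := hindep.comp (fun _ => Prod.snd) fun _ => measurable_snd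
  have hSident : ∀ i, IdentDistrib (S i) (S 0) P P := fun i => (hident i).comp measurable_snd
  obtain ⟨g, hg, hgs⟩ := exists_condExp_comap_eq P (hS 0) hint
  intro ε hε
  obtain ⟨η, hη, hηε⟩ : ∃ η : ℝ, 0 < η ∧ ENNReal.ofReal η + ENNReal.ofReal η ≤ ε := by
    obtain ⟨η, -, hη, hηε⟩ := ENNReal.lt_iff_exists_real_btwn.1 hε
    have hη' := ENNReal.ofReal_pos.1 hη
    refine ⟨η / 2, half_pos hη', ?_⟩
    rw [← ENNReal.ofReal_add (half_pos hη').le (half_pos hη').le, add_halves]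
    exact hηε.le
  obtain ⟨a, ha, hasum⟩ := hDonsker.exists_measure_cellFeature_gt_le H hφ hX hS hindep hident
    hint hη
  obtain ⟨b, hb, hbprob⟩ := measure_exists_sqrt_mul_abs_empProb_sub_ge_le hS hSind hSident hη
  set p : 𝕊 → ℝ := fun s => P.real (S 0 ⁻¹' {s})
  -- Summing the cell constants gives one constant for all cells; null cells add `0`, since `2 / 0 =
  -- 0`.
  set K : ℝ := ∑ s, 2 / p s * (a + b * ‖g s‖)
  have hK0 : ∀ s, 0 ≤ 2 / p s * (a + b * ‖g s‖) := fun s => by positivity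
  have hK : 0 ≤ K := Finset.sum_nonneg fun s _ => hK0 s
  have hrate : Tendsto (fun n : ℕ => b * (n : ℝ) ^ (-(1 / 2) : ℝ)) atTop (𝓝 0) := by
    simpa using ((tendsto_rpow_neg_atTop (by norm_num : (0 : ℝ) < 1 / 2)).comp
      tendsto_natCast_atTop_atTop).const_mul b
  have hsmall : ∀ᶠ n : ℕ in atTop, ∀ s, 0 < p s → b * (n : ℝ) ^ (-(1 / 2) : ℝ) ≤ p s / 2 := by
    refine eventually_all.2 fun s => ?_
    by_cases hs : 0 < p s
    · exact (hrate.eventually (ge_mem_nhds (half_pos hs))).mono fun n hn _ => hn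
    · exact Eventually.of_forall fun n h => absurd h hs
  refine ⟨K + 1, by positivity, ?_⟩
  filter_upwards [hasum, hsmall, eventually_gt_atTop 0] with n hn hsm hn0
  set r : ℝ := (n : ℝ) ^ (-(1 / 2) : ℝ)
  have hnpos : (0 : ℝ) < n := by exact_mod_cast hn0
  have hr : r = (√(n : ℝ))⁻¹ := by rw [Real.sqrt_eq_rpow, ← Real.rpow_neg hnpos.le]
  have hsq : 0 < √(n : ℝ) := Real.sqrt_pos.2 hnpos
  have hr0 : 0 < r := by rw [hr]; positivity
  -- The formula for the conditional norm holds only almost surely, hence an inclusion up to a null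
  -- set.
  refine (measure_mono_ae ?_).trans ((measure_union_le _ _).trans
    ((add_le_add hn (hbprob n hn0)).trans hηε))
  filter_upwards [condL2Norm_plugIn_sub_condMean H hφ hX hS hindep hg n] with ω hω hlt
  by_contra hbad
  have hA := fun s => not_lt.1 fun h => hbad (Or.inl ⟨s, h⟩)
  have hB := fun s => not_le.1 fun h => hbad (Or.inr ⟨s, h⟩)
  refine absurd (show _ < condL2Norm _ _ _ ω from hlt) (not_lt.2 ?_)
  rw [hω]
  have hbound : ∀ s, P (S 0 ⁻¹' {s}) * ‖empCondMean H X S n {s} ω - g s‖ₑ ^ 2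
      ≤ P (S 0 ⁻¹' {s}) * ENNReal.ofReal (K * r) ^ 2 := by
    intro s
    -- On a null cell `g s` is uncontrolled, but its weight vanishes.
    rcases eq_or_ne (P (S 0 ⁻¹' {s})) 0 with h0 | h0
    · simp [h0]
    have hps : 0 < p s := ENNReal.toReal_pos h0 (measure_ne_top _ _)
    gcongr
    rw [← ofReal_norm]
    refine ENNReal.ofReal_le_ofReal ?_
    refine (norm_empCondMean_sub_le H X S (a := a) (b := b) hps (hsm s hps) ?_ ?_).trans ?_
    · rw [hr, ← div_eq_mul_inv, le_div_iff₀' hsq]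
      exact (hB s).le
    · rw [hr, ← div_eq_mul_inv, le_div_iff₀' hsq, hgs s]
      exact hA s
    · exact mul_le_mul_of_nonneg_right
        (Finset.single_le_sum (fun s _ => hK0 s) (Finset.mem_univ s)) hr0.le
  calc _ ≤ (∑ s, P (S 0 ⁻¹' {s}) * ENNReal.ofReal (K * r) ^ 2) ^ (1 / 2 : ℝ) :=
        ENNReal.rpow_le_rpow (Finset.sum_le_sum fun s _ => hbound s) (by norm_num)
    _ = ENNReal.ofReal (K * r) := by
        rw [← Finset.sum_mul, sum_measure_fiber_eq_one P (hS 0), one_mul, ← ENNReal.rpow_natCast,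
          ← ENNReal.rpow_mul]
        norm_num
    _ ≤ _ := ENNReal.ofReal_le_ofReal (by gcongr; linarith)
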